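/- Let $K$ be a field of characteristic $0$ such that $K_{\mathrm{ab}}$, the maximal subextension of $K/\mathbb{Q}$ that is abelian over $\mathbb{Q}$, has finite degree over $\mathbb{Q}$. The Chevalley–Bass number of $K$ is the smallest positive integer $\Lambda$ such that, for every positive integer $n$, $$(K(\zeta_{\Lambda n})^\times)^{\Lambda n}\cap K^\times\subseteq (K^\times)^n,$$ where $\zeta_m$ denotes a primitive $m$-th root of unity. Then the following hold. 1. For every such field $K$ the Chevalley–Bass number exists and is a multiple of $4$. 2. The fields $\mathbb{Q}$ and $\mathbb{Q}(\zeta_4)$ both have Chevalley–Bass number $4$. 3. For every positive integer $r$ with $4\mid r$, the Chevalley–Bass number of $\mathbb{Q}(\zeta_r)$ is $r$. 4. For every odd positive integer $r$, the Chevalley–Bass number of $\mathbb{Q}(\zeta_r)$ is $4r$. 5. Every positive multiple of $4$ is the Chevalley–Bass number of some cyclotomic field $\mathbb{Q}(\zeta_r)$, $r\ge 1$. -/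

import Mathlib

/-- The maximal abelian subextension `K_ab / ℚ` of a field extension `K / ℚ`: the compositum
inside `K` of all the subfields of `K` that are Galois over `ℚ` with abelian Galois group. -/
noncomputable def maxAbelianSubextension (K : Type*) [Field K] [CharZero K] :
    IntermediateField ℚ K :=
  ⨆ F : {F : IntermediateField ℚ K // IsAbelianGalois ℚ F}, F.1

/-- The Chevalley-Bass property of the integer `Λ` for the field `K`: for every positive integer
`n`, one has `(K(ζ_{Λn})ˣ)^{Λn} ∩ Kˣ ⊆ (Kˣ)^n`. -/
def HasChevalleyBassProperty (K : Type*) [Field K] (Λ : ℕ) : Prop :=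
  ∀ n : ℕ, 0 < n → ∀ x : Kˣ,
    (∃ y : (CyclotomicField (Λ * n) K)ˣ,
      y ^ (Λ * n) = Units.map (algebraMap K (CyclotomicField (Λ * n) K)).toMonoidHom x) →
    ∃ z : Kˣ, z ^ n = x

/-- `Λ` is the Chevalley-Bass number of `K`: such a number exists, and `Λ` is the smallest
positive integer with the Chevalley-Bass property. -/
def IsChevalleyBassNumber (K : Type*) [Field K] (Λ : ℕ) : Prop :=
  IsLeast {m : ℕ | 0 < m ∧ HasChevalleyBassProperty K m} Λ

/-! Upper bound: call `m` closed for `K` if level `m` already captures every element of `K` lying in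
a cyclotomic field of level divisible by `m`. Finiteness of `K_ab` gives such an `m`. Galois theory
then realises any power map on N-th roots of unity (`m ∣ N`) with exponent congruent to 1 mod `m`
over `K` (`IsCyclotomicallyClosed.exists_algEquiv`). One such automorphism per prime, together with
commutativity of the Galois group, shows that every closed multiple of 4 has the Chevalley-Bass
property.

Lower bound: if `K` contains a primitive d-th root of unity, the Gauss sum of a character of order d
has a power in `K`, and the property applied to it forces `d ∣ Λ`. When `i` is not in `K`, the
element `1 + i` forces `4 ∣ Λ`. For cyclotomic fields the two bounds meet. -/

namespace ChevalleyBass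

/-! ### Cyclotomic subfields and closed levels -/

/-- The subfield of `L` generated over `ℚ` by the `m`-th roots of unity. -/
noncomputable def cyclotomicSubfield (m : ℕ) (L : Type*) [Field L] [CharZero L] :
    IntermediateField ℚ L :=
  IntermediateField.adjoin ℚ {b : L | ∃ k ∈ ({m} : Set ℕ), k ≠ 0 ∧ b ^ k = 1}

theorem cyclotomicSubfield_map {m N : ℕ} [NeZero N] (hmN : m ∣ N) {L M : Type*} [Field L]
    [CharZero L] [Field M] [CharZero M] (f : L →ₐ[ℚ] M) {ζ : L} (hζ : IsPrimitiveRoot ζ N) :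
    (cyclotomicSubfield m L).map f = cyclotomicSubfield m M := by
  rw [cyclotomicSubfield, cyclotomicSubfield, IntermediateField.adjoin_map]
  congr 1
  ext w
  simp only [Set.mem_singleton_iff, exists_eq_left, Set.mem_image, Set.mem_ofPred_eq]
  constructor
  · rintro ⟨b, ⟨hm, hb⟩, rfl⟩
    exact ⟨hm, by rw [← map_pow, hb, map_one]⟩
  · rintro ⟨hm, hw⟩
    have : NeZero m := ⟨hm⟩
    have hw' : w ^ N = 1 := by
      obtain ⟨c, rfl⟩ := hmN
      rw [pow_mul, hw, one_pow]
    obtain ⟨i, -, rfl⟩ := (hζ.map_of_injective f.injective).eq_pow_of_pow_eq_one hw'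
    refine ⟨ζ ^ i, ⟨hm, f.injective ?_⟩, by simp⟩
    simpa using hw

theorem map_mem_cyclotomicSubfield {m N : ℕ} [NeZero N] (hmN : m ∣ N) {L M : Type*} [Field L]
    [CharZero L] [Field M] [CharZero M] (f : L →+* M) {ζ : L} (hζ : IsPrimitiveRoot ζ N) {z : L} :
    f z ∈ cyclotomicSubfield m M ↔ z ∈ cyclotomicSubfield m L := by
  rw [← cyclotomicSubfield_map hmN f.toRatAlgHom hζ]
  exact ⟨fun ⟨w, hw, h⟩ => f.injective h ▸ hw, fun h => ⟨z, h, rfl⟩⟩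

theorem isCyclotomicExtension_cyclotomicSubfield (m : ℕ) [NeZero m] {L : Type*} [Field L]
    [CharZero L] {ζ : L} (hζ : IsPrimitiveRoot ζ m) :
    IsCyclotomicExtension {m} ℚ (cyclotomicSubfield m L) :=
  IntermediateField.isCyclotomicExtension_adjoin_of_exists_isPrimitiveRoot {m} ℚ L
    fun n hn _ => ⟨ζ, by obtain rfl := Set.mem_singleton_iff.1 hn; exact hζ⟩

theorem cyclotomicSubfield_mono {m n : ℕ} (hmn : m ∣ n) (hn : n ≠ 0) (L : Type*) [Field L]
    [CharZero L] : cyclotomicSubfield m L ≤ cyclotomicSubfield n L := by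
  refine IntermediateField.adjoin.mono _ _ _ ?_
  rintro b ⟨k, rfl, -, hb⟩
  obtain ⟨c, rfl⟩ := hmn
  exact ⟨_, rfl, hn, by rw [pow_mul, hb, one_pow]⟩

/-- The intersection of `K` with the `m`-th cyclotomic field. -/
noncomputable def cyclotomicPart (m : ℕ) (K : Type*) [Field K] [CharZero K] :
    IntermediateField ℚ K :=
  (cyclotomicSubfield m (AlgebraicClosure K)).comap
    (algebraMap K (AlgebraicClosure K)).toRatAlgHom

theorem mem_cyclotomicPart {m : ℕ} {K : Type*} [Field K] [CharZero K] {z : K} :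
    z ∈ cyclotomicPart m K ↔
      algebraMap K (AlgebraicClosure K) z ∈ cyclotomicSubfield m (AlgebraicClosure K) :=
  Iff.rfl

theorem exists_isPrimitiveRoot_algebraicClosure (K : Type*) [Field K] [CharZero K] (N : ℕ)
    [NeZero N] : ∃ ζ : AlgebraicClosure K, IsPrimitiveRoot ζ N :=
  HasEnoughRootsOfUnity.exists_primitiveRoot _ N

/-- The cyclotomic part may be tested in any algebraic extension with enough roots of unity: embed
it in the algebraic closure. -/
theorem algebraMap_mem_cyclotomicSubfield {m N : ℕ} [NeZero N] (hmN : m ∣ N) {K L : Type*}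
    [Field K] [CharZero K] [Field L] [CharZero L] [Algebra K L] [Algebra.IsAlgebraic K L] {ζ : L}
    (hζ : IsPrimitiveRoot ζ N) {z : K} :
    algebraMap K L z ∈ cyclotomicSubfield m L ↔ z ∈ cyclotomicPart m K := by
  let f : L →ₐ[K] AlgebraicClosure K := IsAlgClosed.lift
  rw [mem_cyclotomicPart, ← f.commutes z]
  exact (map_mem_cyclotomicSubfield hmN f.toRingHom hζ).symm

theorem cyclotomicPart_mono {m n : ℕ} (hmn : m ∣ n) (hn : n ≠ 0) (K : Type*) [Field K]
    [CharZero K] : cyclotomicPart m K ≤ cyclotomicPart n K :=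
  fun _ hz => cyclotomicSubfield_mono hmn hn _ hz

theorem cyclotomicPart_le_maxAbelianSubextension (m : ℕ) [NeZero m] (K : Type*) [Field K]
    [CharZero K] : cyclotomicPart m K ≤ maxAbelianSubextension K := by
  obtain ⟨ζ, hζ⟩ := exists_isPrimitiveRoot_algebraicClosure K m
  have := isCyclotomicExtension_cyclotomicSubfield m hζ
  have : IsAbelianGalois ℚ (cyclotomicSubfield m (AlgebraicClosure K)) :=
    IsCyclotomicExtension.isAbelianGalois {m} ℚ _
  let f : cyclotomicPart m K →+* cyclotomicSubfield m (AlgebraicClosure K) :=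
    ((algebraMap K (AlgebraicClosure K)).comp (cyclotomicPart m K).val.toRingHom).codRestrict
      (cyclotomicSubfield m (AlgebraicClosure K)) fun x => x.2
  have : IsAbelianGalois ℚ (cyclotomicPart m K) := IsAbelianGalois.of_algHom f.toRatAlgHom
  exact le_iSup (fun F : {F : IntermediateField ℚ K // IsAbelianGalois ℚ F} => F.1)
    ⟨cyclotomicPart m K, this⟩

/-- All the elements of `K` lying in some cyclotomic field whose level is a multiple of `m` lie in
the `m`-th cyclotomic field. -/
def IsCyclotomicallyClosed (m : ℕ) (K : Type*) [Field K] [CharZero K] : Prop :=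
  ∀ N : ℕ, 0 < N → m ∣ N → cyclotomicPart N K ≤ cyclotomicPart m K

theorem IsCyclotomicallyClosed.of_dvd {m n : ℕ} (hmn : m ∣ n) (hn : n ≠ 0) {K : Type*} [Field K]
    [CharZero K] (h : IsCyclotomicallyClosed m K) : IsCyclotomicallyClosed n K :=
  fun N hN hnN => (h N hN (hmn.trans hnN)).trans (cyclotomicPart_mono hmn hn K)

theorem exists_isCyclotomicallyClosed (K : Type*) [Field K] [CharZero K]
    [FiniteDimensional ℚ (maxAbelianSubextension K)] :
    ∃ m : ℕ, 0 < m ∧ IsCyclotomicallyClosed m K := by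
  let d : ℕ → ℕ := fun m => Module.finrank ℚ (cyclotomicPart m K)
  have hle : ∀ m : ℕ, 0 < m → cyclotomicPart m K ≤ maxAbelianSubextension K := fun m hm =>
    have : NeZero m := ⟨hm.ne'⟩
    cyclotomicPart_le_maxAbelianSubextension m K
  have hfin : ∀ m : ℕ, 0 < m → FiniteDimensional ℚ (cyclotomicPart m K) := fun m hm =>
    FiniteDimensional.of_injective (IntermediateField.inclusion (hle m hm)).toLinearMap
      (IntermediateField.inclusion (hle m hm)).injective
  have hbdd : BddAbove (d '' {m | 0 < m}) := by
    refine ⟨Module.finrank ℚ (maxAbelianSubextension K), ?_⟩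
    rintro _ ⟨m, hm, rfl⟩
    exact LinearMap.finrank_le_finrank_of_injective
      (f := (IntermediateField.inclusion (hle m hm)).toLinearMap)
      (IntermediateField.inclusion (hle m hm)).injective
  -- A level whose cyclotomic part has maximal degree is closed, since passing to a multiple can
  -- only enlarge that part.
  obtain ⟨m, hm, hmax⟩ := Nat.sSup_mem (Set.Nonempty.image d ⟨1, Nat.one_pos⟩) hbdd
  refine ⟨m, hm, fun N hN hmN => ?_⟩
  have := hfin N hN
  refine (IntermediateField.eq_of_le_of_finrank_le (cyclotomicPart_mono hmN hN.ne' K) ?_).ge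
  exact (le_csSup hbdd ⟨N, hN, rfl⟩).trans hmax.ge

theorem isCyclotomicallyClosed_of_isCyclotomicExtension {r m : ℕ} (hr : r ∣ m) (hm : 0 < m)
    (K : Type*) [Field K] [CharZero K] [IsCyclotomicExtension {r} ℚ K] :
    IsCyclotomicallyClosed m K := by
  have : NeZero r := ⟨ne_zero_of_dvd_ne_zero hm.ne' hr⟩
  intro N _ _ z _
  refine cyclotomicPart_mono hr hm.ne' K ?_
  rw [mem_cyclotomicPart]
  refine (map_mem_cyclotomicSubfield dvd_rfl _ (IsCyclotomicExtension.zeta_spec r ℚ K)).2 ?_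
  have h := ((IsCyclotomicExtension.iff_adjoin_eq_top {r} ℚ K).1 inferInstance).2
  exact IntermediateField.algebra_adjoin_le_adjoin ℚ _ (h ▸ Algebra.mem_top)

/-! ### Lifting power maps to automorphisms over `K` -/

/-- Power maps on roots of unity that are trivial on the roots of unity of order dividing `m` come
from automorphisms over `K`. -/
theorem IsCyclotomicallyClosed.exists_algEquiv {m N : ℕ} [NeZero N] (hmN : m ∣ N) {K L : Type*}
    [Field K] [CharZero K] [Field L] [Algebra K L] [IsCyclotomicExtension {N} K L]
    (h : IsCyclotomicallyClosed m K) {a : ℕ} (ha : a.Coprime N) (ham : a ≡ 1 [MOD m]) :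
    ∃ τ : L ≃ₐ[K] L, ∀ w : L, w ^ N = 1 → τ w = w ^ a := by
  have : CharZero L := charZero_of_injective_algebraMap (algebraMap K L).injective
  have : IsGalois K L := IsCyclotomicExtension.isGalois {N} K L
  have : FiniteDimensional K L := IsCyclotomicExtension.finiteDimensional {N} K L
  have hζ : IsPrimitiveRoot (IsCyclotomicExtension.zeta N K L) N :=
    IsCyclotomicExtension.zeta_spec N K L
  let E := cyclotomicSubfield N L
  have : IsCyclotomicExtension {N} ℚ E := isCyclotomicExtension_cyclotomicSubfield N hζ
  have : IsGalois ℚ E := IsCyclotomicExtension.isGalois {N} ℚ E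
  have : FiniteDimensional ℚ E := IsCyclotomicExtension.finiteDimensional {N} ℚ E
  have hirr := Polynomial.cyclotomic.irreducible_rat (NeZero.pos N)
  let α : E ≃ₐ[ℚ] E := (IsCyclotomicExtension.autEquivPow E hirr).symm (ZMod.unitOfCoprime a ha)
  have hαζ : ∀ w : E, w ^ N = 1 → α w = w ^ a := by
    intro w hw
    have hz := IsCyclotomicExtension.zeta_spec N ℚ E
    have h1 : hz.autToPow ℚ α = ZMod.unitOfCoprime a ha :=
      (IsCyclotomicExtension.autEquivPow E hirr).apply_symm_apply _
    have h2 := hz.autToPow_spec ℚ α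
    rw [h1, ZMod.coe_unitOfCoprime, ZMod.val_natCast, ← pow_eq_pow_mod a hz.pow_eq_one] at h2
    obtain ⟨i, -, rfl⟩ := hz.eq_pow_of_pow_eq_one hw
    rw [map_pow, ← h2, ← pow_mul, ← pow_mul, mul_comm]
  let φ : (L ≃ₐ[K] L) →* (E ≃ₐ[ℚ] E) :=
    (AlgEquiv.restrictNormalHom E).comp (AlgEquiv.restrictScalarsHom ℚ)
  have hφ : ∀ τ (e : E), ((φ τ e : E) : L) = τ e := fun τ e =>
    AlgEquiv.restrictNormal_commutes (τ.restrictScalars ℚ) E e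
  -- By the Galois correspondence it suffices that `α` fixes the fixed field of the image. Such
  -- elements come from `K`, so closedness puts them at level `m`, where `α` is trivial because `a ≡
  -- 1`.
  have hα : α ∈ φ.range := by
    rw [← IntermediateField.fixingSubgroup_fixedField φ.range,
      IntermediateField.mem_fixingSubgroup_iff]
    intro e he
    have hfix : ∀ τ : L ≃ₐ[K] L, τ e = e := fun τ => by
      rw [← hφ]
      exact congrArg _ (he ⟨φ τ, τ, rfl⟩)
    obtain ⟨z, hz⟩ := (IsGalois.mem_range_algebraMap_iff_fixed (F := K) (e : L)).2 hfix
    have hzN : z ∈ cyclotomicPart N K := by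
      rw [← algebraMap_mem_cyclotomicSubfield dvd_rfl hζ, hz]
      exact e.2
    have hzm : (e : L) ∈ cyclotomicSubfield m L := by
      rw [← hz, algebraMap_mem_cyclotomicSubfield hmN hζ]
      exact h N (NeZero.pos N) hmN hzN
    have key : cyclotomicSubfield m L ≤
        (IntermediateField.fixedField (Subgroup.zpowers α)).map E.val := by
      refine IntermediateField.adjoin_le_iff.2 ?_
      rintro w ⟨k, rfl, -, hw⟩
      have hwN : w ^ N = 1 := by
        obtain ⟨c, hc⟩ := hmN
        rw [hc, pow_mul, hw, one_pow]
      refine ⟨⟨w, IntermediateField.subset_adjoin _ _ ⟨N, rfl, NeZero.ne N, hwN⟩⟩, ?_, rfl⟩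
      have hfx : α ⟨w, IntermediateField.subset_adjoin _ _ ⟨N, rfl, NeZero.ne N, hwN⟩⟩ =
          ⟨w, IntermediateField.subset_adjoin _ _ ⟨N, rfl, NeZero.ne N, hwN⟩⟩ := by
        rw [hαζ _ (Subtype.ext hwN)]
        refine Subtype.ext ?_
        exact (pow_eq_pow_of_modEq ham hw).trans (pow_one w)
      intro ⟨β, hβ⟩
      have : Subgroup.zpowers α ≤ MulAction.stabilizer (E ≃ₐ[ℚ] E)
          (⟨w, IntermediateField.subset_adjoin _ _ ⟨N, rfl, NeZero.ne N, hwN⟩⟩ : E) := by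
        rw [Subgroup.zpowers_le]
        exact hfx
      exact this hβ
    obtain ⟨e', he', hee'⟩ := key hzm
    obtain rfl : e' = e := Subtype.ext hee'
    exact he' ⟨α, Subgroup.mem_zpowers α⟩
  obtain ⟨τ, hτ⟩ := hα
  refine ⟨τ, fun w hw => ?_⟩
  have := hφ τ ⟨w, IntermediateField.subset_adjoin _ _ ⟨N, rfl, NeZero.ne N, hw⟩⟩
  rw [hτ, hαζ _ (Subtype.ext hw)] at this
  exact this.symm


/-! ### The Chevalley-Bass property at a closed multiple of 4 -/

/-- Lifting the exponent for `(1 + D) ^ p ^ j - 1`, divided by `D`. At `p = 2` this needs `4 ∣ D`,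
which is where the factor 4 enters. -/
theorem geom_sum_prime_pow {p D : ℕ} [hp : Fact p.Prime] (hD : D ≠ 0) (hpD : p ∣ D)
    (h2 : p = 2 → 4 ∣ D) (j : ℕ) :
    ∃ S : ℕ, S.Coprime p ∧ ∑ i ∈ Finset.range (p ^ j), (1 + D) ^ i = p ^ j * S := by
  have hpZ : Prime (p : ℤ) := Nat.prime_iff_prime_int.1 hp.out
  have hp1 : ¬ (p : ℤ) ∣ 1 + D := fun h =>
    hpZ.not_dvd_one ((Int.dvd_add_left (Int.natCast_dvd_natCast.2 hpD)).1 h)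
  have hlte : emultiplicity (p : ℤ) ((1 + D : ℤ) ^ p ^ j - 1 ^ p ^ j) =
      emultiplicity (p : ℤ) (1 + D - 1 : ℤ) + emultiplicity (p : ℤ) ((p ^ j : ℕ) : ℤ) := by
    rcases hp.out.eq_two_or_odd' with rfl | hodd
    · refine Int.two_pow_sub_pow' _ ?_ hp1
      have := Int.natCast_dvd_natCast.2 (h2 rfl)
      simpa using this
    · rw [Int.emultiplicity_pow_sub_pow hp.out hodd _ hp1, Int.natCast_emultiplicity]
      simpa using Int.natCast_dvd_natCast.2 hpD
  have hgeom : (∑ i ∈ Finset.range (p ^ j), (1 + D : ℤ) ^ i) * (1 + D - 1 : ℤ) =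
      (1 + D : ℤ) ^ p ^ j - 1 ^ p ^ j := by
    rw [geom_sum_mul, one_pow]
  rw [← hgeom, emultiplicity_mul hpZ, add_comm] at hlte
  have hfin : FiniteMultiplicity (p : ℤ) (1 + D - 1 : ℤ) :=
    Int.finiteMultiplicity_iff.2 ⟨by simpa using hp.out.ne_one, by simpa using hD⟩
  have h := ENat.add_right_injective_of_ne_top
    (finiteMultiplicity_iff_emultiplicity_ne_top.1 hfin) hlte
  rw [Nat.cast_pow, emultiplicity_pow_self_of_prime hpZ, emultiplicity_eq_coe] at h
  obtain ⟨⟨S, hS⟩, hnd⟩ := h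
  have hcast : ((∑ i ∈ Finset.range (p ^ j), (1 + D) ^ i : ℕ) : ℤ) = (p : ℤ) ^ j * S := by
    push_cast
    exact hS
  have hdvd : p ^ j ∣ ∑ i ∈ Finset.range (p ^ j), (1 + D) ^ i := by
    rw [← Int.natCast_dvd_natCast, hcast]
    exact ⟨S, by push_cast; rfl⟩
  obtain ⟨T, hT⟩ := hdvd
  refine ⟨T, ?_, hT⟩
  rw [Nat.coprime_comm, hp.out.coprime_iff_not_dvd]
  rintro ⟨R, rfl⟩
  refine hnd ⟨R, ?_⟩
  rw [hS, ← hcast, hT]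
  push_cast
  ring

section Twist

variable {K L : Type*} [Field K] [Field L] [Algebra K L] [IsAbelianGalois K L]

/-- Correct `y` by a root of unity so that `τ` fixes it. Each `σ y' / y'` is then a root of unity
fixed by `τ`, as `σ` and `τ` commute, so its order divides `p ^ s` and `y' ^ p ^ s` descends to `K`.
-/
theorem exists_pow_eq_of_twist [FiniteDimensional K L] {p v s u k : ℕ} [hp : Fact p.Prime]
    (hsv : s ≤ v) {ζ : L} (hζ : IsPrimitiveRoot ζ (p ^ v)) {x : K} {y : L} (hy0 : y ≠ 0)
    (hy : y ^ p ^ v = algebraMap K L x) (τ : L ≃ₐ[K] L) (hτ : τ ζ = ζ ^ (1 + p ^ s * u))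
    (hu : u.Coprime p) (hk : τ y = ζ ^ (p ^ s * k) * y) :
    ∃ z : K, z ^ p ^ (v - s) = x := by
  have hpv : NeZero (p ^ v) := ⟨pow_ne_zero _ hp.out.ne_zero⟩
  have hζ0 : ζ ≠ 0 := hζ.ne_zero (NeZero.ne _)
  let w : ℕ := ((u : ZMod (p ^ v))⁻¹).val
  have hw : u * w ≡ 1 [MOD p ^ v] := by
    rw [← ZMod.natCast_eq_natCast_iff, Nat.cast_mul, ZMod.natCast_zmod_val,
      ZMod.coe_mul_inv_eq_one u (hu.pow_right v), Nat.cast_one]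
  -- With `w` inverse to `u`, `τ` multiplies `c` by the same factor as `y`.
  let c : L := ζ ^ (w * k)
  have hc0 : c ≠ 0 := pow_ne_zero _ hζ0
  have hcv : c ^ p ^ v = 1 := by rw [← pow_mul, mul_comm, pow_mul, hζ.pow_eq_one, one_pow]
  have hτc : τ c = ζ ^ (p ^ s * k) * c := by
    rw [map_pow, hτ, ← pow_mul, ← pow_add]
    refine pow_eq_pow_of_modEq ?_ hζ.pow_eq_one
    calc (1 + p ^ s * u) * (w * k) = p ^ s * k * (u * w) + w * k := by ring
      _ ≡ p ^ s * k * 1 + w * k [MOD p ^ v] := (hw.mul_left _).add_right _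
      _ = p ^ s * k + w * k := by rw [mul_one]
  let y' : L := y / c
  have hy'0 : y' ≠ 0 := div_ne_zero hy0 hc0
  have hτy' : τ y' = y' := by
    rw [map_div₀, hτc, hk, mul_div_mul_left _ _ (pow_ne_zero _ hζ0)]
  have hy' : y' ^ p ^ v = algebraMap K L x := by rw [div_pow, hcv, div_one, hy]
  have hfix : ∀ σ : L ≃ₐ[K] L, σ (y' ^ p ^ s) = y' ^ p ^ s := by
    intro σ
    have hρ1 : (σ y' / y') ^ p ^ v = 1 := by
      rw [div_pow, ← map_pow, hy', σ.commutes, div_self]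
      rw [← hy']
      exact pow_ne_zero _ hy'0
    have hρ0 : σ y' / y' ≠ 0 := div_ne_zero (by simpa using hy'0) hy'0
    have hτρ : τ (σ y' / y') = σ y' / y' := by
      have hcomm : τ (σ y') = σ (τ y') :=
        DFunLike.congr_fun (IsMulCommutative.is_comm.comm τ σ) y'
      rw [map_div₀, hcomm, hτy']
    obtain ⟨i, -, hi⟩ := hζ.eq_pow_of_pow_eq_one hρ1
    have hτρ' : τ (σ y' / y') = (σ y' / y') ^ (1 + p ^ s * u) := by
      rw [← hi, map_pow, hτ, ← pow_mul, ← pow_mul, mul_comm]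
    rw [hτρ, pow_add, pow_one, eq_comm, mul_eq_left₀ hρ0] at hτρ'
    have hord : orderOf (σ y' / y') ∣ p ^ s := by
      have h1 := Nat.dvd_gcd (orderOf_dvd_of_pow_eq_one hτρ') (orderOf_dvd_of_pow_eq_one hρ1)
      obtain ⟨t, rfl⟩ := Nat.exists_eq_add_of_le hsv
      rwa [pow_add, Nat.gcd_mul_left, (hu.pow_right t).gcd_eq_one, mul_one] at h1
    have h2 := orderOf_dvd_iff_pow_eq_one.1 hord
    rwa [div_pow, div_eq_one_iff_eq (pow_ne_zero _ hy'0), ← map_pow] at h2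
  obtain ⟨z, hz⟩ := (IsGalois.mem_range_algebraMap_iff_fixed (F := K) (y' ^ p ^ s)).2 hfix
  refine ⟨z, (algebraMap K L).injective ?_⟩
  rw [map_pow, hz, ← pow_mul, ← pow_add, Nat.add_sub_cancel' hsv, hy']

omit [IsAbelianGalois K L] in
theorem iterate_twist (τ : L ≃ₐ[K] L) {ζ y : L} {a k : ℕ} (hτ : τ ζ = ζ ^ a)
    (hk : τ y = ζ ^ k * y) (i : ℕ) :
    (τ ^ i) y = ζ ^ (k * ∑ t ∈ Finset.range i, a ^ t) * y := by
  induction i with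
  | zero => simp
  | succ i ih =>
    rw [pow_succ', AlgEquiv.mul_apply, ih, map_mul, map_pow, hτ, hk, geom_sum_succ, ← pow_mul,
      ← mul_assoc, ← pow_add]
    congr 2
    ring

omit [IsAbelianGalois K L] in
theorem iterate_pow (τ : L ≃ₐ[K] L) {ζ : L} {a : ℕ} (hτ : τ ζ = ζ ^ a) (i : ℕ) :
    (τ ^ i) ζ = ζ ^ a ^ i := by
  induction i with
  | zero => simp
  | succ i ih => rw [pow_succ', AlgEquiv.mul_apply, ih, map_pow, hτ, ← pow_mul, ← pow_succ']

end Twist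

/-- The part at `p` of the Chevalley-Bass property. -/
theorem IsCyclotomicallyClosed.exists_prime_pow_eq {Λ : ℕ} (h4 : 4 ∣ Λ) (hΛ : 0 < Λ) {K : Type*}
    [Field K] [CharZero K] (h : IsCyclotomicallyClosed Λ K) {n : ℕ} (hn : 0 < n) {L : Type*}
    [Field L] [Algebra K L] [IsCyclotomicExtension {Λ * n} K L] {x : K} {y : L} (hy0 : y ≠ 0)
    (hy : y ^ (Λ * n) = algebraMap K L x) {p : ℕ} (hp : p.Prime) :
    ∃ z : K, z ^ p ^ n.factorization p = x := by
  have : Fact p.Prime := ⟨hp⟩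
  have : NeZero (Λ * n) := ⟨(Nat.mul_pos hΛ hn).ne'⟩
  have : IsAbelianGalois K L := IsCyclotomicExtension.isAbelianGalois {Λ * n} K L
  have : FiniteDimensional K L := IsCyclotomicExtension.finiteDimensional {Λ * n} K L
  have hζN := IsCyclotomicExtension.zeta_spec (Λ * n) K L
  obtain ⟨s, Λ', hpΛ', hΛ'⟩ := Nat.exists_eq_pow_mul_and_not_dvd hΛ.ne' p hp.ne_one
  have hn' : n = p ^ n.factorization p * (n / p ^ n.factorization p) :=
    (Nat.ordProj_mul_ordCompl_eq_self n p).symm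
  have hpn' : ¬ p ∣ n / p ^ n.factorization p := Nat.not_dvd_ordCompl hp hn.ne'
  generalize n.factorization p = j at *
  generalize n / p ^ j = n' at *
  have hu : (Λ' * n').Coprime p :=
    ((hp.coprime_iff_not_dvd.2 hpΛ').mul_right (hp.coprime_iff_not_dvd.2 hpn')).symm
  have hNu : Λ * n = Λ' * n' * p ^ (s + j) := by rw [hΛ', hn']; ring
  have hND : Λ * n = Λ * n' * p ^ j := by rw [hn']; ring
  have hζ := hζN.pow (Nat.mul_pos hΛ hn) hNu
  have hy1 : (y ^ (Λ' * n')) ^ p ^ (s + j) = algebraMap K L x := by rw [← pow_mul, ← hNu, hy]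
  have hy10 : y ^ (Λ' * n') ≠ 0 := pow_ne_zero _ hy0
  have hpv : NeZero (p ^ (s + j)) := ⟨pow_ne_zero _ hp.ne_zero⟩
  have hk : ∀ τ : L ≃ₐ[K] L, ∃ k, τ (y ^ (Λ' * n')) =
      (IsCyclotomicExtension.zeta (Λ * n) K L ^ (Λ' * n')) ^ k * y ^ (Λ' * n') := by
    intro τ
    have h1 : (τ (y ^ (Λ' * n')) / y ^ (Λ' * n')) ^ p ^ (s + j) = 1 := by
      rw [div_pow, ← map_pow, hy1, τ.commutes, div_self]
      rw [← hy1]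
      exact pow_ne_zero _ hy10
    obtain ⟨k, -, hk⟩ := hζ.eq_pow_of_pow_eq_one h1
    exact ⟨k, by rw [hk, div_mul_cancel₀ _ hy10]⟩
  have hζ1 : (IsCyclotomicExtension.zeta (Λ * n) K L ^ (Λ' * n')) ^ (Λ * n) = 1 := by
    rw [pow_right_comm, hζN.pow_eq_one, one_pow]
  rcases Nat.eq_zero_or_pos j with rfl | hj
  · exact ⟨x, by simp⟩
  rcases Nat.eq_zero_or_pos s with rfl | hs
  · rw [pow_zero, one_mul] at hΛ'
    subst hΛ'
    have hcop : (Λ * n').Coprime (p ^ j) := hu.pow_right j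
    -- The exponent `1 + u` is 1 mod `Λ * n'` and 2 mod `p ^ j`: a unit because `p` is odd.
    obtain ⟨u, hu0, hu1⟩ := Nat.chineseRemainder hcop 0 1
    have hup : u ≡ 1 [MOD p] := hu1.of_dvd (dvd_pow_self p hj.ne')
    have hucop : u.Coprime p := by
      have := hup.gcd_eq
      rwa [Nat.gcd_one_left] at this
    have hp2 : p ≠ 2 := by
      rintro rfl
      exact hpΛ' ((by norm_num : 2 ∣ 4).trans h4)
    have ha : (1 + u).Coprime (Λ * n) := by
      rw [hND]
      refine Nat.Coprime.mul_right ?_ (Nat.Coprime.pow_right j ?_)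
      · have := (hu0.add_left 1).gcd_eq
        rwa [add_zero, Nat.gcd_one_left] at this
      · have := (hup.add_left 1).gcd_eq
        have h2 : Nat.Coprime 2 p := (Nat.coprime_primes Nat.prime_two hp).2 (Ne.symm hp2)
        exact this.trans h2
    have ham : 1 + u ≡ 1 [MOD Λ] := by
      simpa using (hu0.of_dvd (Dvd.intro _ rfl)).add_left 1
    obtain ⟨τ, hτ⟩ := h.exists_algEquiv (L := L) (Dvd.intro n rfl) ha ham
    obtain ⟨k, hk⟩ := hk τ
    have := exists_pow_eq_of_twist (s := 0) (k := k) (u := u) (Nat.zero_le _) hζ hy10 hy1 τ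
      (by rw [hτ _ hζ1, pow_zero, one_mul]) hucop (by rw [hk, pow_zero, one_mul])
    simpa using this
  · have hDs : Λ * n' = p ^ s * (Λ' * n') := by rw [hΛ', mul_assoc]
    have hn'0 : n' ≠ 0 := by
      rintro rfl
      simp at hpn'
    have hpD : p ∣ Λ * n' := hDs ▸ (dvd_pow_self p hs.ne').mul_right _
    obtain ⟨S, hS, hsum⟩ := geom_sum_prime_pow (p := p) (Nat.mul_ne_zero hΛ.ne' hn'0) hpD
      (fun _ => h4.mul_right _) j
    have ha : (1 + Λ * n').Coprime (Λ * n) := by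
      rw [hND]
      refine Nat.Coprime.mul_right (by simp) (Nat.Coprime.pow_right j ?_)
      exact Nat.Coprime.coprime_dvd_right hpD (by simp)
    have ham : 1 + Λ * n' ≡ 1 [MOD Λ] := by simp [Nat.ModEq]
    obtain ⟨τ, hτ⟩ := h.exists_algEquiv (L := L) (Dvd.intro n rfl) ha ham
    -- `(1 + Λ * n') ^ p ^ j` exceeds 1 by `p ^ j * S * (Λ * n')`, a multiple of `Λ * n`.
    have hτp : τ ^ p ^ j = 1 := by
      refine IsCyclotomicExtension.algEquiv_eq_of_apply_eq {Λ * n} K L fun m hm hm0 => ?_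
      obtain rfl := Set.mem_singleton_iff.1 hm
      refine ⟨_, hζN, ?_⟩
      rw [iterate_pow τ (hτ _ hζN.pow_eq_one), AlgEquiv.one_apply]
      refine (pow_eq_pow_of_modEq ?_ hζN.pow_eq_one).trans (pow_one _)
      have hgeom := geom_sum_mul_add (Λ * n') (p ^ j)
      rw [add_comm (Λ * n') 1, hsum] at hgeom
      rw [← hgeom, hND]
      have : p ^ j * S * (Λ * n') + 1 = 1 + (Λ * n' * p ^ j) * S := by ring
      rw [this]
      simp [Nat.ModEq]
    obtain ⟨k, hk⟩ := hk τ
    -- Applying `τ ^ p ^ j = 1` to the root gives `p ^ (s + j) ∣ k * (p ^ j * S)`; as `S` is prime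
    -- to `p`, this makes `k` divisible by `p ^ s`.
    have hit := iterate_twist τ (hτ _ hζ1) hk (p ^ j)
    rw [hτp, AlgEquiv.one_apply, eq_comm, mul_eq_right₀ hy10, hsum] at hit
    have hdvd := hζ.dvd_of_pow_eq_one _ hit
    have hsk : p ^ s ∣ k := by
      rw [pow_add, mul_comm (p ^ s), mul_left_comm] at hdvd
      exact (hS.symm.pow_left s).dvd_of_dvd_mul_right
        (Nat.dvd_of_mul_dvd_mul_left (pow_pos hp.pos j) hdvd)
    obtain ⟨k', rfl⟩ := hsk
    have := exists_pow_eq_of_twist (s := s) (Nat.le_add_right s j) hζ hy10 hy1 τ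
      (by rw [hτ _ hζ1, hDs]) hu hk
    simpa using this

theorem exists_pow_eq_of_forall_prime {G : Type*} [CommGroup G] {x : G} :
    ∀ n : ℕ, 0 < n → (∀ p : ℕ, p.Prime → ∃ z : G, z ^ p ^ n.factorization p = x) →
      ∃ z : G, z ^ n = x := by
  intro n
  induction n using Nat.recOnPosPrimePosCoprime with
  | zero => exact fun h => absurd h (lt_irrefl 0)
  | one => exact fun _ _ => ⟨x, pow_one x⟩
  | prime_pow p k hp hk =>
    intro _ h
    simpa [hp.factorization_pow] using h p hp
  | coprime a b ha hb hab iha ihb =>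
    intro _ h
    have ha0 : 0 < a := by omega
    have hb0 : 0 < b := by omega
    have aux : ∀ c, c ∣ a * b → c ≠ 0 → ∀ p : ℕ, p.Prime →
        ∃ z : G, z ^ p ^ c.factorization p = x := by
      intro c hc hc0 p hp
      obtain ⟨z, hz⟩ := h p hp
      obtain ⟨t, ht⟩ := Nat.exists_eq_add_of_le
        ((Nat.factorization_le_iff_dvd hc0 (Nat.mul_ne_zero ha0.ne' hb0.ne')).2 hc p)
      refine ⟨z ^ p ^ t, ?_⟩
      rw [← pow_mul, ← pow_add, add_comm, ← ht, hz]
    obtain ⟨z₁, h₁⟩ := iha ha0 (aux a (Dvd.intro b rfl) ha0.ne')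
    obtain ⟨z₂, h₂⟩ := ihb hb0 (aux b (Dvd.intro_left a rfl) hb0.ne')
    have hbez : (a : ℤ) * a.gcdA b + b * a.gcdB b = 1 := by
      rw [← Nat.gcd_eq_gcd_ab, hab.gcd_eq_one, Nat.cast_one]
    refine ⟨z₁ ^ a.gcdB b * z₂ ^ a.gcdA b, ?_⟩
    calc (z₁ ^ a.gcdB b * z₂ ^ a.gcdA b) ^ (a * b)
        = (z₁ ^ a) ^ (b * a.gcdB b) * (z₂ ^ b) ^ (a * a.gcdA b) := by
          rw [← zpow_natCast, mul_zpow]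
          simp only [← zpow_natCast, ← zpow_mul]
          congr 2 <;> push_cast <;> ring
      _ = x := by rw [h₁, h₂, ← zpow_add, add_comm, hbez, zpow_one]

theorem IsCyclotomicallyClosed.hasChevalleyBassProperty {Λ : ℕ} (h4 : 4 ∣ Λ) (hΛ : 0 < Λ)
    {K : Type*} [Field K] [CharZero K] (h : IsCyclotomicallyClosed Λ K) :
    HasChevalleyBassProperty K Λ := by
  rintro n hn x ⟨y, hy⟩
  have : NeZero (Λ * n) := ⟨(Nat.mul_pos hΛ hn).ne'⟩
  refine exists_pow_eq_of_forall_prime n hn fun p hp => ?_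
  obtain ⟨z, hz⟩ := h.exists_prime_pow_eq h4 hΛ hn (L := CyclotomicField (Λ * n) K) (x := x)
    y.ne_zero (by simpa using congrArg Units.val hy) hp
  have hz0 : z ≠ 0 := by
    rintro rfl
    rw [zero_pow (pow_ne_zero _ hp.ne_zero)] at hz
    exact x.ne_zero hz.symm
  exact ⟨Units.mk0 z hz0, Units.ext (by simpa using hz)⟩


/-! ### Lower bounds from Gauss sums and from `1 + i` -/

/-- An automorphism multiplies a Gauss sum by the inverse value of its character. -/
theorem mul_map_gaussSum {K L : Type*} [Field K] [Field L] [Algebra K L] {p : ℕ} [Fact p.Prime]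
    (χ : MulChar (ZMod p) K) {ζ : L} (hζ : ζ ^ p = 1) (τ : L ≃ₐ[K] L) (a : (ZMod p)ˣ)
    (hτ : τ ζ = ζ ^ (a : ZMod p).val) :
    algebraMap K L (χ a) *
        τ (gaussSum (χ.ringHomComp (algebraMap K L)) (AddChar.zmodChar p hζ)) =
      gaussSum (χ.ringHomComp (algebraMap K L)) (AddChar.zmodChar p hζ) := by
  have h : τ (gaussSum (χ.ringHomComp (algebraMap K L)) (AddChar.zmodChar p hζ)) =
      gaussSum (χ.ringHomComp (algebraMap K L)) ((AddChar.zmodChar p hζ).mulShift a) := by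
    simp only [gaussSum, map_sum, map_mul, MulChar.ringHomComp_apply, τ.commutes,
      AddChar.mulShift_apply, AddChar.zmodChar_apply, map_pow, hτ, ← pow_mul]
    refine Finset.sum_congr rfl fun b _ => ?_
    congr 1
    refine pow_eq_pow_of_modEq ?_ hζ
    rw [ZMod.val_mul]
    exact (Nat.mod_modEq _ _).symm
  rw [h, ← MulChar.ringHomComp_apply, gaussSum_mulShift]

theorem dvd_of_hasChevalleyBassProperty {K : Type*} [Field K] [CharZero K] {m d Λ : ℕ}
    (hm : 0 < m) (h : IsCyclotomicallyClosed m K) (hd : 0 < d) {ξ : K} (hξ : IsPrimitiveRoot ξ d)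
    (hΛ : 0 < Λ) (hCB : HasChevalleyBassProperty K Λ) : d ∣ Λ := by
  rcases eq_or_ne d 1 with rfl | hd1
  · exact one_dvd Λ
  -- The congruence provides a character mod `p` of order `d`; the size of `p` makes it prime to `Λ
  -- * d * m`.
  obtain ⟨p, hp, hlt, hmod⟩ := Nat.exists_prime_gt_modEq_one (Λ * d * m) hd.ne'
  have : Fact p.Prime := ⟨hp⟩
  have hN'0 : 0 < Λ * d * m := Nat.mul_pos (Nat.mul_pos hΛ hd) hm
  have hcop : p.Coprime (Λ * d * m) :=
    hp.coprime_iff_not_dvd.2 fun hdvd => (Nat.le_of_dvd hN'0 hdvd).not_gt hlt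
  have hpΛ : d.Coprime p := (hcop.coprime_dvd_right ⟨Λ * m, by ring⟩).symm
  have hn : 0 < d * p * m := Nat.mul_pos (Nat.mul_pos hd hp.pos) hm
  have hN : Λ * (d * p * m) = Λ * d * m * p := by ring
  have : NeZero (Λ * (d * p * m)) := ⟨(Nat.mul_pos hΛ hn).ne'⟩
  obtain ⟨χ, hχ⟩ := MulChar.exists_mulChar_orderOf (ZMod p) (n := d)
    (by rw [ZMod.card]; exact (Nat.modEq_iff_dvd' hp.one_le).1 hmod.symm) hξ
  let L := CyclotomicField (Λ * (d * p * m)) K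
  have : IsGalois K L := IsCyclotomicExtension.isGalois {Λ * (d * p * m)} K L
  have : FiniteDimensional K L := IsCyclotomicExtension.finiteDimensional {Λ * (d * p * m)} K L
  have : CharZero L := charZero_of_injective_algebraMap (algebraMap K L).injective
  have hζN : IsPrimitiveRoot (IsCyclotomicExtension.zeta (Λ * (d * p * m)) K L) _ :=
    IsCyclotomicExtension.zeta_spec (Λ * (d * p * m)) K L
  obtain ⟨ζ, hζ⟩ : ∃ ζ : L, IsPrimitiveRoot ζ p := ⟨_, hζN.pow (NeZero.pos _) hN⟩
  let y : L := gaussSum (χ.ringHomComp (algebraMap K L)) (AddChar.zmodChar p hζ.pow_eq_one)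
  have hy0 : y ≠ 0 := by
    refine gaussSum_ne_zero_of_nontrivial ?_ ?_ (AddChar.zmodChar_primitive_of_primitive_root p hζ)
    · rw [ZMod.card]
      exact Nat.cast_ne_zero.2 hp.ne_zero
    · rw [MulChar.ringHomComp_ne_one_iff (algebraMap K L).injective]
      rintro rfl
      exact hd1 (hχ.symm.trans orderOf_one)
  have hχN : ∀ a : (ZMod p)ˣ, χ a ^ (Λ * (d * p * m)) = 1 := fun a => by
    rw [← MulChar.pow_apply_coe, orderOf_dvd_iff_pow_eq_one.1 (hχ.dvd.trans ⟨Λ * p * m, by ring⟩),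
      MulChar.one_apply_coe]
  have hfix : ∀ τ : L ≃ₐ[K] L, τ (y ^ (Λ * (d * p * m))) = y ^ (Λ * (d * p * m)) := by
    intro τ
    have h1 := mul_map_gaussSum χ hζ.pow_eq_one τ (hζ.autToPow K τ) (hζ.autToPow_spec K τ).symm
    have h2 := congrArg (· ^ (Λ * (d * p * m))) h1
    simp only [mul_pow] at h2
    rw [← map_pow (algebraMap K L), hχN, map_one, one_mul] at h2
    rw [map_pow]
    exact h2
  obtain ⟨x, hx⟩ := (IsGalois.mem_range_algebraMap_iff_fixed (F := K) _).2 hfix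
  have hx0 : x ≠ 0 := by
    rintro rfl
    rw [map_zero] at hx
    exact pow_ne_zero _ hy0 hx.symm
  obtain ⟨z, hz⟩ := hCB (d * p * m) hn (Units.mk0 x hx0)
    ⟨Units.mk0 y hy0, Units.ext (by simpa using hx.symm)⟩
  have hzx : (z : K) ^ (d * p * m) = x := by simpa using congrArg Units.val hz
  have hz0 : algebraMap K L z ≠ 0 := by simp
  -- The property makes `y ^ Λ` an element of `K` up to the root of unity `ω`.
  let ω : L := y ^ Λ / algebraMap K L z
  have hω0 : ω ≠ 0 := div_ne_zero (pow_ne_zero _ hy0) hz0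
  have hωn : ω ^ (d * p * m) = 1 := by
    rw [div_pow, ← pow_mul, ← map_pow, hzx, hx, div_self (pow_ne_zero _ hy0)]
  have hωN : ω ^ (Λ * (d * p * m)) = 1 :=
    orderOf_dvd_iff_pow_eq_one.1 ((orderOf_dvd_of_pow_eq_one hωn).trans (Dvd.intro_left Λ rfl))
  have hχΛ : ∀ a : (ZMod p)ˣ, χ a ^ (Λ * p) = 1 := by
    intro a
    -- This automorphism acts as `a` on p-th roots of unity but fixes `ω ^ p`, which isolates `χ a ^
    -- (Λ * p)`.
    obtain ⟨u, hu0, hu1⟩ := Nat.chineseRemainder hcop.symm 1 (a : ZMod p).val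
    have hu : u.Coprime (Λ * (d * p * m)) := by
      rw [hN]
      refine Nat.Coprime.mul_right ?_ ?_
      · have := hu0.gcd_eq
        rwa [Nat.gcd_one_left] at this
      · exact hu1.gcd_eq.trans (ZMod.val_coe_unit_coprime a)
    obtain ⟨τ, hτ⟩ := h.exists_algEquiv (L := L) ⟨Λ * (d * p), by ring⟩ hu
      (hu0.of_dvd ⟨Λ * d, by ring⟩)
    have hζN1 : ζ ^ (Λ * (d * p * m)) = 1 :=
      (hζ.pow_eq_one_iff_dvd _).2 ⟨Λ * d * m, by ring⟩
    have h1 := mul_map_gaussSum χ hζ.pow_eq_one τ a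
      ((hτ ζ hζN1).trans (pow_eq_pow_of_modEq hu1 hζ.pow_eq_one))
    change algebraMap K L (χ a) * τ y = y at h1
    have h2 : algebraMap K L (χ a) ^ Λ * τ ω = ω := by
      rw [map_div₀, τ.commutes, map_pow, ← mul_div_assoc, ← mul_pow, h1]
    have h3 : (τ ω) ^ p = ω ^ p := by
      rw [hτ ω hωN, ← pow_mul]
      refine pow_eq_pow_of_modEq ?_ hωN
      rw [hN]
      simpa using hu0.mul_right' p
    have h4 := congrArg (· ^ p) h2
    simp only [mul_pow] at h4
    rw [h3, mul_eq_right₀ (pow_ne_zero _ hω0), ← pow_mul, ← map_pow] at h4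
    exact (algebraMap K L).injective (h4.trans (map_one _).symm)
  have hone : χ ^ (Λ * p) = 1 := by
    rw [MulChar.eq_one_iff]
    intro a
    rw [MulChar.pow_apply_coe, hχΛ]
  exact hpΛ.dvd_of_dvd_mul_right (hχ ▸ orderOf_dvd_of_pow_eq_one hone)

theorem isPrimitiveRoot_four {K : Type*} [Field K] [CharZero K] {i : K} (hi : i ^ 2 = -1) :
    IsPrimitiveRoot i 4 := by
  have : orderOf i = 2 ^ (1 + 1) := orderOf_eq_prime_pow
    (by rw [pow_one, hi]; norm_num) (by rw [pow_succ, pow_one, pow_mul, hi]; norm_num)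
  exact (IsPrimitiveRoot.iff_orderOf).2 this

/-- If `i` is not in `K` and `Λ = 2 * l` with `l` odd, then `(1 + i) ^ (4 * l) = (-4) ^ l = -(2 ^ l)
^ 2` would have to be a square in `K`. -/
theorem four_dvd_of_hasChevalleyBassProperty {K : Type*} [Field K] [CharZero K] {m Λ : ℕ}
    (hm : 0 < m) (h : IsCyclotomicallyClosed m K) (hΛ : 0 < Λ)
    (hCB : HasChevalleyBassProperty K Λ) : 4 ∣ Λ := by
  by_cases hi : ∃ i : K, i ^ 2 = -1
  · obtain ⟨i, hi⟩ := hi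
    exact dvd_of_hasChevalleyBassProperty hm h four_pos (isPrimitiveRoot_four hi) hΛ hCB
  obtain ⟨l, rfl⟩ := dvd_of_hasChevalleyBassProperty hm h two_pos (IsPrimitiveRoot.neg_one 0
    (by norm_num)) hΛ hCB
  by_contra h4
  have hl : Odd l := by
    rw [← Nat.not_even_iff_odd]
    rintro ⟨c, rfl⟩
    exact h4 ⟨c, by ring⟩
  have : NeZero (2 * l * 2) := ⟨by positivity⟩
  let L := CyclotomicField (2 * l * 2) K
  have : CharZero L := charZero_of_injective_algebraMap (algebraMap K L).injective
  have hζ : IsPrimitiveRoot (IsCyclotomicExtension.zeta (2 * l * 2) K L) _ :=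
    IsCyclotomicExtension.zeta_spec (2 * l * 2) K L
  obtain ⟨I, hI⟩ : ∃ I : L, I ^ 2 = -1 := by
    refine ⟨IsCyclotomicExtension.zeta (2 * l * 2) K L ^ l, ?_⟩
    have := (hζ.pow (a := l * 2) (b := 2) (NeZero.pos _) (by ring)).eq_neg_one_of_two_right
    rw [← pow_mul, this]
  have hy : (1 + I) ^ (2 * l * 2) = algebraMap K L (-(2 ^ l) ^ 2) := by
    have h1 : (1 + I) ^ 4 = -4 := by linear_combination (I ^ 2 + 4 * I + 5) * hI
    have h2 : (1 + I) ^ (2 * l * 2) = ((1 + I) ^ 4) ^ l := by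
      rw [← pow_mul]
      congr 1
      ring
    rw [h2, h1, hl.neg_pow, ← pow_mul, mul_comm l 2, pow_mul]
    norm_num [map_ofNat]
  have hx0 : (-(2 ^ l) ^ 2 : K) ≠ 0 := by simp
  have hy0 : (1 + I) ≠ 0 := by
    intro h0
    rw [h0, zero_pow (NeZero.ne _), eq_comm, map_eq_zero] at hy
    exact hx0 hy
  obtain ⟨z, hz⟩ := hCB 2 two_pos (Units.mk0 _ hx0)
    ⟨Units.mk0 (1 + I) hy0, Units.ext (by simpa using hy)⟩
  have hz' : (z : K) ^ 2 = -(2 ^ l) ^ 2 := by simpa using congrArg Units.val hz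
  refine hi ⟨z / 2 ^ l, ?_⟩
  rw [div_pow, hz', neg_div, div_self (by simp)]

/-! ### Cyclotomic fields and existence -/

theorem isChevalleyBassNumber_of_isCyclotomicExtension {r : ℕ} (hr : 0 < r) (h4 : 4 ∣ r)
    (K : Type*) [Field K]
    [CharZero K] [hQ : Algebra ℚ K] [IsCyclotomicExtension {r} ℚ K] :
    IsChevalleyBassNumber K r := by
  obtain rfl : hQ = DivisionRing.toRatAlgebra := Subsingleton.elim _ _
  have : NeZero r := ⟨hr.ne'⟩
  have h := isCyclotomicallyClosed_of_isCyclotomicExtension (dvd_refl r) hr K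
  refine ⟨⟨hr, h.hasChevalleyBassProperty h4 hr⟩, fun Λ ⟨hΛ, hCB⟩ => Nat.le_of_dvd hΛ ?_⟩
  exact dvd_of_hasChevalleyBassProperty hr h hr (IsCyclotomicExtension.zeta_spec r ℚ K) hΛ hCB

theorem isChevalleyBassNumber_of_isCyclotomicExtension_of_odd {r : ℕ} (hr : Odd r)
    (K : Type*) [Field K]
    [CharZero K] [hQ : Algebra ℚ K] [IsCyclotomicExtension {r} ℚ K] :
    IsChevalleyBassNumber K (4 * r) := by
  have hr0 : 0 < 4 * r := Nat.mul_pos four_pos hr.pos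
  obtain rfl : hQ = DivisionRing.toRatAlgebra := Subsingleton.elim _ _
  have : NeZero r := ⟨hr.pos.ne'⟩
  have h := isCyclotomicallyClosed_of_isCyclotomicExtension (Dvd.intro_left 4 rfl) hr0 K
  refine ⟨⟨hr0, h.hasChevalleyBassProperty (Dvd.intro r rfl) hr0⟩,
    fun Λ ⟨hΛ, hCB⟩ => Nat.le_of_dvd hΛ ?_⟩
  refine Nat.Coprime.mul_dvd_of_dvd_of_dvd ?_
    (four_dvd_of_hasChevalleyBassProperty hr0 h hΛ hCB)
    (dvd_of_hasChevalleyBassProperty hr0 h hr.pos (IsCyclotomicExtension.zeta_spec r ℚ K) hΛ hCB)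
  exact Nat.Coprime.pow_left 2 (Nat.coprime_two_left.2 hr)

theorem exists_isChevalleyBassNumber (K : Type*) [Field K] [CharZero K]
    [FiniteDimensional ℚ (maxAbelianSubextension K)] :
    ∃ Λ : ℕ, IsChevalleyBassNumber K Λ ∧ 4 ∣ Λ := by
  obtain ⟨m, hm, h⟩ := exists_isCyclotomicallyClosed K
  have hm4 : 0 < 4 * m := Nat.mul_pos four_pos hm
  have hne : {Λ : ℕ | 0 < Λ ∧ HasChevalleyBassProperty K Λ}.Nonempty :=
    ⟨4 * m, hm4, (h.of_dvd (Dvd.intro_left 4 rfl) hm4.ne').hasChevalleyBassProperty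
      (Dvd.intro m rfl) hm4⟩
  have hmem := Nat.sInf_mem hne
  exact ⟨_, ⟨hmem, fun _ => Nat.sInf_le⟩,
    four_dvd_of_hasChevalleyBassProperty hm h hmem.1 hmem.2⟩

end ChevalleyBass

theorem mainTheorem9 :
    (∀ (K : Type*) [Field K] [CharZero K],
      FiniteDimensional ℚ (maxAbelianSubextension K) →
        ∃ Λ : ℕ, IsChevalleyBassNumber K Λ ∧ 4 ∣ Λ) ∧
    IsChevalleyBassNumber ℚ 4 ∧
    IsChevalleyBassNumber (CyclotomicField 4 ℚ) 4 ∧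
    (∀ r : ℕ, 0 < r → 4 ∣ r → IsChevalleyBassNumber (CyclotomicField r ℚ) r) ∧
    (∀ r : ℕ, Odd r → IsChevalleyBassNumber (CyclotomicField r ℚ) (4 * r)) ∧
    (∀ m : ℕ, 0 < m → 4 ∣ m →
      ∃ r : ℕ, 0 < r ∧ IsChevalleyBassNumber (CyclotomicField r ℚ) m) := by
  have hcyc : ∀ r : ℕ, 0 < r → 4 ∣ r → IsChevalleyBassNumber (CyclotomicField r ℚ) r :=
    fun r hr h4 =>
      ChevalleyBass.isChevalleyBassNumber_of_isCyclotomicExtension hr h4 _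
        (hQ := CyclotomicField.algebra r ℚ)
  refine ⟨fun K _ _ _ => ChevalleyBass.exists_isChevalleyBassNumber K, ?_,
    hcyc 4 four_pos dvd_rfl, hcyc, fun r hr => ?_, fun m hm h4 => ⟨m, hm, hcyc m hm h4⟩⟩
  -- `ℚ` is the odd case with `r = 1`.
  · have : IsCyclotomicExtension {1} ℚ ℚ := IsCyclotomicExtension.singleton_one_of_bot_eq_top
      (Subsingleton.elim _ _)
    exact ChevalleyBass.isChevalleyBassNumber_of_isCyclotomicExtension_of_odd odd_one ℚ
  · exact ChevalleyBass.isChevalleyBassNumber_of_isCyclotomicExtension_of_odd hr _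
      (hQ := CyclotomicField.algebra r ℚ)
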